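/- **Setting.** Let $\mathbb I$ be a finite input space, $N=|\mathbb I|$. A control-flow graph has a set of basic blocks, directed edges, and sets of entry and exit blocks; a program $P$ with this graph assigns to each input $i\in\mathbb I$ an entry-to-exit path $\pi_{P(i)}$ of the graph. Fix a target edge that lies on some but not on every entry-to-exit path; an input $i$ reaches the target if $\pi_{P(i)}$ contains the target edge. An oracle with $c$ bits and failure probability $p$ assigns to every program $P$ and every query $q$ (queries range over an arbitrary set, for example input regions $I\subseteq\mathbb I$ or pairs of regions) an arbitrary correct answer $O_P(q)\in\{0,1\}^c$; whenever $q$ is queried, the response is $O_P(q)$ with each of its $c$ bits flipped independently with probability $p$, independently of all other queries (for $c=1$: the answer is incorrect with probability $p$). A fuzzing algorithm knows the graph, the target and the parameters, but learns about $P$ only through queries; it is randomized and adaptive, and at each step either makes a query or halts and outputs an input. It succeeds with probability at least $1-\delta$ if, for every program $P$ with the given graph for which some input reaches the target, it outputs an input reaching the target with probability at least $1-\delta$. Its expected execution complexity on $P$ is the expected number of queries it makes in a run (possibly $\infty$). **Theorem.** Given any oracle that returns a constant $c$ bits of information with failure probability $p<\frac12$ per query, any fuzzing algorithm that succeeds with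 probability at least $1-\delta$ has expected execution complexity $\Omega\!\left((1-\delta)\frac{\log N}{(\frac12-p)^2}\right)$ in the worst case over programs. Precisely: for every $c$ there is a constant $K>0$, depending only on $c$, such that for every $\delta\in[0,1]$ there is $N_0$, depending only on $c$ and $\delta$, such that for every input space of size $N\ge N_0$, every control-flow graph and target edge as above, every $p\in[0,\frac12)$, every oracle with $c$ bits and failure probability $p$, and every fuzzing algorithm that succeeds with probability at least $1-\delta$, there is a program with this graph, for which some input reaches the target, on which the expected number of queries is at least $K(1-\delta)\log N/(\frac12-p)^2$. -/

import Mathlib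

open scoped ENNReal

/-- A control-flow graph: basic blocks `V`, control-flow transitions (the edges of a digraph),
and the program entry and program exit blocks. -/
structure ControlFlowGraph (V : Type*) extends Digraph V where
  entry : Set V
  exit : Set V

namespace ControlFlowGraph

variable {V : Type*}

/-- An entry-to-exit path: a finite nonempty sequence of edges of the graph, consecutive edges
being adjacent, starting at an entry block and ending at an exit block. -/
structure EntryExitPath (G : ControlFlowGraph V) where
  edges : List (V × V)
  ne_nil : edges ≠ []
  adj : ∀ e ∈ edges, G.Adj e.1 e.2
  chain : edges.IsChain (fun e f => e.2 = f.1)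
  starts : (edges.head ne_nil).1 ∈ G.entry
  ends : (edges.getLast ne_nil).2 ∈ G.exit

/-- A path reaches a target edge if it traverses it. -/
def EntryExitPath.Reaches {G : ControlFlowGraph V} (π : G.EntryExitPath) (target : V × V) : Prop :=
  target ∈ π.edges

/-- A program with control-flow graph `G` and input space `𝕀`, given by its executions: running
it on the input `i` follows the path `P i`.  Nothing else is assumed of a program. -/
abbrev Program (G : ControlFlowGraph V) (𝕀 : Type*) := 𝕀 → G.EntryExitPath

end ControlFlowGraph

/-- A string of `c` bits. -/
abbrev Bits (c : ℕ) := Fin c → Bool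

/-- The response of the oracle when the correct answer is the bit string `a`: each of the `c` bits
is, independently, wrong with probability `p` and right with probability `1 - p`. -/
noncomputable def noisyResponse (p : unitInterval) {c : ℕ} (a : Bits c) : PMF (Bits c) :=
  PMF.ofFintype
    (fun y => ∏ j, if y j = a j then ENNReal.ofReal (1 - (p : ℝ)) else ENNReal.ofReal (p : ℝ))
    (by
      have h := Finset.prod_univ_sum (fun _ : Fin c => (Finset.univ : Finset Bool))
        (fun j b => if b = a j then ENNReal.ofReal (1 - (p : ℝ)) else ENNReal.ofReal (p : ℝ))
      rw [Fintype.piFinset_univ] at h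
      rw [← h]
      refine Finset.prod_eq_one fun j _ => ?_
      have h1 : ENNReal.ofReal (1 - (p : ℝ)) + ENNReal.ofReal (p : ℝ) = 1 := by
        rw [← ENNReal.ofReal_add (by linarith [p.2.2]) p.2.1]
        simp
      cases a j <;> simp [h1, add_comm (ENNReal.ofReal (p : ℝ))])

/-- What a fuzzing algorithm may do next: halt and output an input, or make the query `q`, after
which its memory becomes `next y`, where `y` is the response it receives. -/
inductive FuzzerAction (𝕀 Q M : Type*) (c : ℕ) where
  | output (i : 𝕀)
  | query (q : Q) (next : Bits c → M)

/-- A randomized adaptive fuzzing algorithm with input space `𝕀`, oracle queries in `Q`, responses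
of `c` bits, and memory contents in `M` (for instance all previous queries, responses and coin
flips).  Given the memory, the next action is drawn at random. -/
structure Fuzzer (𝕀 Q M : Type*) (c : ℕ) where
  init : M
  act : M → PMF (FuzzerAction 𝕀 Q M c)

namespace Fuzzer

variable {𝕀 Q M : Type*} {c : ℕ}

/-- The first `n` actions of the algorithm, started with memory `m`, when the correct answer to
the query `q` is `O q` and every response has fresh noise: the joint law of the output (`none` as
long as the algorithm has not halted) and the number of queries made. -/
noncomputable def run (F : Fuzzer 𝕀 Q M c) (p : unitInterval) (O : Q → Bits c) :
    ℕ → M → PMF (Option 𝕀 × ℕ)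
  | 0, _ => PMF.pure (none, 0)
  | n + 1, m => (F.act m).bind fun
      | .output i => PMF.pure (some i, 0)
      | .query q next => (noisyResponse p (O q)).bind fun y =>
          (F.run p O n (next y)).map fun r => (r.1, r.2 + 1)

/-- The probability that the algorithm ever halts with an output in `S`: the limit (here a
supremum, the sequence being nondecreasing) of the probabilities for the first `n` actions. -/
noncomputable def successProb (F : Fuzzer 𝕀 Q M c) (p : unitInterval) (O : Q → Bits c)
    (S : Set 𝕀) : ℝ≥0∞ :=
  ⨆ n, (F.run p O n F.init).toOuterMeasure {r | ∃ i ∈ S, r.1 = some i}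

/-- The expected number of oracle queries in a whole run, possibly infinite: the limit (here a
supremum, the sequence being nondecreasing) of the expectations for the first `n` actions. -/
noncomputable def expectedQueries (F : Fuzzer 𝕀 Q M c) (p : unitInterval) (O : Q → Bits c) :
    ℝ≥0∞ :=
  ⨆ n, ∑' r, F.run p O n F.init r * (r.2 : ℝ≥0∞)

end Fuzzer

/-! Compare the true run with one at failure probability 1/2. There responses are uniform bits, so
the run ignores the program and some input `i` is output with probability at most `1/N`
(`exists_expect_half_le`). Let `P` reach the target on `i` only, so that success means outputting
`i`. The Donsker–Varadhan inequality E[f] ≤ KL + log E_ref[exp f], with f = log N if `i` is output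
and 0 otherwise, has left side at least (1 - δ) log N, while E_ref[exp f] ≤ 2. By the chain rule KL
is at most `responseInfo`, of order (1/2 - p)², times the expected number of queries. For large N
the term log 2 is absorbed. `entropy_inequality` proves this by induction on the number of actions,
building in the chain rule without defining KL on runs. -/

namespace PMF

/-! ### Expectations as sums against a `PMF` -/

variable {α β : Type*}

theorem tsum_bind_mul (p : PMF α) (f : α → PMF β) (g : β → ℝ≥0∞) :
    ∑' b, p.bind f b * g b = ∑' a, p a * ∑' b, f a b * g b := by
  simp_rw [PMF.bind_apply, ← ENNReal.tsum_mul_right, ← ENNReal.tsum_mul_left]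
  rw [ENNReal.tsum_comm]
  simp_rw [mul_assoc]

theorem tsum_pure_mul (a : α) (g : β → ℝ≥0∞) (f : α → β) :
    ∑' b, PMF.pure (f a) b * g b = g (f a) := by
  rw [tsum_eq_single (f a)]
  · simp
  · intro b hb
    simp [PMF.pure_apply, hb]

theorem tsum_map_mul (p : PMF α) (f : α → β) (g : β → ℝ≥0∞) :
    ∑' b, p.map f b * g b = ∑' a, p a * g (f a) := by
  rw [← PMF.bind_pure_comp, tsum_bind_mul]
  exact tsum_congr fun a => by rw [Function.comp_apply, tsum_pure_mul]

theorem tsum_mul_const (p : PMF α) (a : ℝ≥0∞) : ∑' x, p x * a = a := by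
  rw [ENNReal.tsum_mul_right, p.tsum_coe, one_mul]

end PMF

/-! ### Information content of one noisy response -/

section Noise

variable {c : ℕ}

/-- The failure probability `1 / 2`, at which responses carry no information. -/
noncomputable def halfNoise : unitInterval := ⟨1 / 2, by norm_num, by norm_num⟩

theorem noisyResponse_half (a z : Bits c) :
    noisyResponse halfNoise a z = ENNReal.ofReal ((1 / 2) ^ c) := by
  have h : ∀ j, (if z j = a j then ENNReal.ofReal (1 - (halfNoise : ℝ))
      else ENNReal.ofReal (halfNoise : ℝ)) = ENNReal.ofReal (1 / 2) := by
    intro j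
    split_ifs <;> norm_num [halfNoise]
  simp only [noisyResponse, PMF.ofFintype_apply, h, Finset.prod_const, Finset.card_univ,
    Fintype.card_fin]
  rw [ENNReal.ofReal_pow (by norm_num)]

theorem noisyResponse_half_eq (a b : Bits c) :
    noisyResponse halfNoise a = noisyResponse halfNoise b := by
  ext z
  rw [noisyResponse_half, noisyResponse_half]

/-- The probability of the response `z` when the correct answer is `a`, as a real number. -/
noncomputable def noiseWeight (p : ℝ) (a z : Bits c) : ℝ := ∏ j, if z j = a j then 1 - p else p

theorem noiseWeight_nonneg (p : unitInterval) (a z : Bits c) : 0 ≤ noiseWeight p a z :=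
  Finset.prod_nonneg fun j _ => by
    split_ifs
    · linarith [p.2.2]
    · exact p.2.1

theorem noisyResponse_apply (p : unitInterval) (a z : Bits c) :
    noisyResponse p a z = ENNReal.ofReal (noiseWeight p a z) := by
  rw [noiseWeight, ENNReal.ofReal_prod_of_nonneg]
  · rw [noisyResponse, PMF.ofFintype_apply]
    exact Finset.prod_congr rfl fun j _ => by split_ifs <;> rfl
  · intro j _
    split_ifs
    · linarith [p.2.2]
    · exact p.2.1

theorem sum_prod_bits (f : Bool → Bool → ℝ) (a : Bits c) :
    ∑ z : Bits c, ∏ j, f (z j) (a j) = ∏ j, (f true (a j) + f false (a j)) := by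
  have h := Finset.prod_univ_sum (fun _ : Fin c => (Finset.univ : Finset Bool))
    (fun j b => f b (a j))
  rw [Fintype.piFinset_univ] at h
  rw [← h]
  simp

theorem sum_noiseWeight (p : ℝ) (a : Bits c) : ∑ z, noiseWeight p a z = 1 := by
  have h := sum_prod_bits (fun x y => if x = y then 1 - p else p) a
  simp only [noiseWeight]
  rw [h]
  refine Finset.prod_eq_one fun j _ => ?_
  cases a j <;> simp

theorem sum_noiseWeight_sq (p : ℝ) (a : Bits c) :
    ∑ z, noiseWeight p a z ^ 2 = (p ^ 2 + (1 - p) ^ 2) ^ c := by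
  have h := sum_prod_bits (fun x y => (if x = y then 1 - p else p) ^ 2) a
  simp only [noiseWeight, ← Finset.prod_pow]
  rw [h]
  have h2 : ∀ j, ((if true = a j then 1 - p else p) ^ 2 + (if false = a j then 1 - p else p) ^ 2)
      = p ^ 2 + (1 - p) ^ 2 := by
    intro j
    cases a j <;> simp [add_comm]
  rw [Finset.prod_congr rfl fun j _ => h2 j]
  simp

/-- The chord of a convex function on [0, 1]. It makes the χ² bound linear in (1/2 - p)². -/
theorem one_add_pow_le_one_add_two_pow_mul (x : ℝ) (h0 : 0 ≤ x) (h1 : x ≤ 1) (n : ℕ) :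
    (1 + x) ^ n ≤ 1 + (2 ^ n - 1) * x := by
  induction n with
  | zero => simp
  | succ n ih =>
    have h2 : (1 : ℝ) ≤ 2 ^ n := one_le_pow₀ (by norm_num)
    calc (1 + x) ^ (n + 1) = (1 + x) ^ n * (1 + x) := pow_succ _ _
      _ ≤ (1 + (2 ^ n - 1) * x) * (1 + x) := by gcongr
      _ ≤ 1 + (2 ^ (n + 1) - 1) * x := by
        rw [pow_succ]
        nlinarith [mul_nonneg (sub_nonneg.2 h2) (mul_nonneg h0 (sub_nonneg.2 h1))]

/-- A bound for the information, in nats, that one response carries. -/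
noncomputable def responseInfo (c : ℕ) (p : ℝ) : ℝ := 2 ^ c * (4 * (1 / 2 - p) ^ 2)

theorem responseInfo_nonneg (c : ℕ) (p : ℝ) : 0 ≤ responseInfo c p := by
  unfold responseInfo
  positivity

/-- The relative entropy of a noisy response with respect to a uniform one. -/
theorem sum_noiseWeight_mul_log_le (p : unitInterval) (a : Bits c) :
    ∑ z, noiseWeight p a z * Real.log (noiseWeight p a z * 2 ^ c) ≤ responseInfo c p := by
  have hx : 4 * (1 / 2 - (p : ℝ)) ^ 2 ≤ 1 := by nlinarith [p.2.1, p.2.2]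
  calc ∑ z, noiseWeight p a z * Real.log (noiseWeight p a z * 2 ^ c)
      -- Relative entropy is at most χ²-divergence, by log x ≤ x - 1.
      ≤ ∑ z, (noiseWeight p a z ^ 2 * 2 ^ c - noiseWeight p a z) := by
        refine Finset.sum_le_sum fun z _ => ?_
        rcases (noiseWeight_nonneg p a z).eq_or_lt with h | h
        · simp [← h]
        · have := Real.log_le_sub_one_of_pos (x := noiseWeight p a z * 2 ^ c) (by positivity)
          nlinarith
    _ = (1 + 4 * (1 / 2 - (p : ℝ)) ^ 2) ^ c - 1 := by
        rw [Finset.sum_sub_distrib, ← Finset.sum_mul, sum_noiseWeight, sum_noiseWeight_sq,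
          ← mul_pow]
        congr 2
        ring
    _ ≤ responseInfo c p := by
        have := one_add_pow_le_one_add_two_pow_mul _ (by positivity) hx c
        have h4 : 0 ≤ 4 * (1 / 2 - (p : ℝ)) ^ 2 := by positivity
        unfold responseInfo
        linarith

end Noise

/-! ### Change of measure along a run -/

namespace Fuzzer

variable {𝕀 Q M : Type*} {c : ℕ}

/-- The expectation of `g` after the first `n` actions, started with memory `m`. -/
noncomputable def expect (F : Fuzzer 𝕀 Q M c) (p : unitInterval) (O : Q → Bits c) (n : ℕ) (m : M)
    (g : Option 𝕀 × ℕ → ℝ≥0∞) : ℝ≥0∞ :=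
  ∑' r, F.run p O n m r * g r

/-- The expectation of `g` after a given action and the `n` actions that follow it. -/
noncomputable def expectAction (F : Fuzzer 𝕀 Q M c) (p : unitInterval) (O : Q → Bits c) (n : ℕ)
    (g : Option 𝕀 × ℕ → ℝ≥0∞) : FuzzerAction 𝕀 Q M c → ℝ≥0∞
  | .output i => g (some i, 0)
  | .query q next => ∑ z, noisyResponse p (O q) z *
      F.expect p O n (next z) fun r => g (r.1, r.2 + 1)

variable (F : Fuzzer 𝕀 Q M c) (p : unitInterval) (O : Q → Bits c)

theorem expect_zero (m : M) (g : Option 𝕀 × ℕ → ℝ≥0∞) : F.expect p O 0 m g = g (none, 0) := by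
  rw [expect, run]
  exact PMF.tsum_pure_mul (none, 0) g id

theorem expect_succ (n : ℕ) (m : M) (g : Option 𝕀 × ℕ → ℝ≥0∞) :
    F.expect p O (n + 1) m g = ∑' x, F.act m x * F.expectAction p O n g x := by
  rw [expect, run, PMF.tsum_bind_mul]
  refine tsum_congr fun x => ?_
  congr 1
  cases x with
  | output i => exact PMF.tsum_pure_mul (some i, 0) g id
  | query q next =>
    simp only [expectAction]
    rw [PMF.tsum_bind_mul, tsum_fintype]
    refine Finset.sum_congr rfl fun z _ => ?_
    rw [PMF.tsum_map_mul, expect]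

theorem expect_add (n : ℕ) (m : M) (g h : Option 𝕀 × ℕ → ℝ≥0∞) :
    F.expect p O n m (fun r => g r + h r) = F.expect p O n m g + F.expect p O n m h := by
  simp only [expect, mul_add, ENNReal.tsum_add]

theorem expect_const (n : ℕ) (m : M) (a : ℝ≥0∞) : F.expect p O n m (fun _ => a) = a :=
  PMF.tsum_mul_const _ _

theorem expect_const_mul (n : ℕ) (m : M) (a : ℝ≥0∞) (g : Option 𝕀 × ℕ → ℝ≥0∞) :
    F.expect p O n m (fun r => a * g r) = a * F.expect p O n m g := by
  simp only [expect, ← ENNReal.tsum_mul_left]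
  exact tsum_congr fun r => by ring

/-- Unhalted runs contribute 0 and halted ones keep their value, so a longer horizon only adds. -/
theorem expect_le_succ (g : Option 𝕀 × ℕ → ℝ≥0∞) (hg : ∀ k, g (none, k) = 0) (n : ℕ) (m : M) :
    F.expect p O n m g ≤ F.expect p O (n + 1) m g := by
  induction n generalizing m g with
  | zero => simp [expect_zero, hg]
  | succ n ih =>
    rw [expect_succ, expect_succ]
    refine ENNReal.tsum_le_tsum fun x => mul_le_mul_right ?_ _
    cases x with
    | output i => exact le_rfl
    | query q next =>
      exact Finset.sum_le_sum fun z _ => mul_le_mul_right (ih (fun r => g (r.1, r.2 + 1)) (fun k => hg _) _) _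

theorem expect_mono (g : Option 𝕀 × ℕ → ℝ≥0∞) (hg : ∀ k, g (none, k) = 0) (m : M) :
    Monotone fun n => F.expect p O n m g :=
  monotone_nat_of_le_succ fun n => F.expect_le_succ p O g hg n m

/-- Without information in the responses, the run does not depend on the correct answers. -/
theorem run_half_eq (O' : Q → Bits c) (n : ℕ) (m : M) :
    F.run halfNoise O n m = F.run halfNoise O' n m := by
  induction n generalizing m with
  | zero => rfl
  | succ n ih =>
    rw [run, run]
    congr 1
    funext x
    cases x with
    | output i => rfl
    | query q next => simp only [ih, noisyResponse_half_eq (O q) (O' q)]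

open Classical in
/-- Half noise as reference measure: the entropy inequality
`E[f] ≤ D + log E_ref[exp f]`, with the logarithm replaced by its tangent at `exp s`, where
`f = log N` if the output is `i` and `f = 0` otherwise. -/
theorem entropy_inequality (i : 𝕀) (N : ℕ) (hN : 1 ≤ N) (n : ℕ) (m : M) (C s : ℝ) (hC : 0 ≤ C)
    (hs : s ≤ C) :
    F.expect p O n m (fun r => if r.1 = some i then ENNReal.ofReal (Real.log N) else 0)
        + (1 + ENNReal.ofReal (C - s))
      ≤ F.expect p O n m (fun r => ENNReal.ofReal (responseInfo c p) * r.2)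
        + (ENNReal.ofReal C + ENNReal.ofReal (Real.exp (-s)) *
          F.expect halfNoise O n m (fun r => if r.1 = some i then (N : ℝ≥0∞) else 1)) := by
  have hNpos : (0 : ℝ) < N := by exact_mod_cast hN
  have hlog : 0 ≤ Real.log N := Real.log_natCast_nonneg N
  have base : ∀ C s : ℝ, 0 ≤ C → s ≤ C →
      1 + ENNReal.ofReal (C - s) ≤ ENNReal.ofReal C + ENNReal.ofReal (Real.exp (-s)) := by
    intro C s hC hs
    rw [← ENNReal.ofReal_one, ← ENNReal.ofReal_add (by norm_num) (by linarith),
      ← ENNReal.ofReal_add hC (Real.exp_pos _).le]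
    refine ENNReal.ofReal_le_ofReal ?_
    linarith [Real.add_one_le_exp (-s)]
  -- The tangent point `s` moves with each response, so it must vary. The offset `C` on both sides
  -- avoids negative terms in `ℝ≥0∞`.
  induction n generalizing m C s with
  | zero => simpa [expect_zero] using base C s hC hs
  | succ n ih =>
    simp only [expect_succ]
    rw [← PMF.tsum_mul_const (F.act m) (1 + ENNReal.ofReal (C - s)),
      ← PMF.tsum_mul_const (F.act m) (ENNReal.ofReal C), ← ENNReal.tsum_mul_left,
      ← ENNReal.tsum_add, ← ENNReal.tsum_add, ← ENNReal.tsum_add]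
    refine ENNReal.tsum_le_tsum fun x => ?_
    rw [mul_left_comm, ← mul_add, ← mul_add, ← mul_add]
    refine mul_le_mul_right ?_ _
    cases x with
    | output j =>
      simp only [expectAction, Option.some.injEq]
      split_ifs with hj
      · rw [Nat.cast_zero, mul_zero, zero_add, ← ENNReal.ofReal_natCast, ← ENNReal.ofReal_one,
          ← ENNReal.ofReal_add (by norm_num) (by linarith),
          ← ENNReal.ofReal_add hlog (by linarith), ← ENNReal.ofReal_mul (Real.exp_pos _).le,
          ← ENNReal.ofReal_add hC (by positivity)]
        refine ENNReal.ofReal_le_ofReal ?_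
        have := Real.add_one_le_exp (-s + Real.log N)
        rw [Real.exp_add, Real.exp_log hNpos] at this
        linarith
      · simpa using base C s hC hs
    | query q next =>
      simp only [expectAction]
      set w : Bits c → ℝ := noiseWeight p (O q) with hw
      have hw0 : ∀ z, 0 ≤ w z := noiseWeight_nonneg p (O q)
      set A : Bits c → ℝ≥0∞ := fun z => F.expect p O n (next z)
        (fun r => if r.1 = some i then ENNReal.ofReal (Real.log N) else 0)
      set B : Bits c → ℝ≥0∞ := fun z => F.expect p O n (next z)
        (fun r => ENNReal.ofReal (responseInfo c p) * r.2)
      set U : Bits c → ℝ≥0∞ := fun z => F.expect halfNoise O n (next z)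
        (fun r => if r.1 = some i then (N : ℝ≥0∞) else 1)
      have hB : ∀ z, F.expect p O n (next z)
          (fun r => ENNReal.ofReal (responseInfo c p) * ((r.2 + 1 : ℕ) : ℝ≥0∞))
          = B z + ENNReal.ofReal (responseInfo c p) := by
        intro z
        simp only [Nat.cast_add, Nat.cast_one, mul_add, mul_one]
        rw [expect_add, expect_const]
      simp only [hB, noisyResponse_half]
      simp only [noisyResponse_apply, ← hw]
      have hsum : ∑ z, ENNReal.ofReal (w z) = 1 := by
        rw [← ENNReal.ofReal_sum_of_nonneg fun z _ => hw0 z, sum_noiseWeight, ENNReal.ofReal_one]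
      -- After the response `z`, `s` is shifted by the log-likelihood ratio; the factor `exp (-s)`
      -- then converts the weight `w z` into the uniform weight `(1 / 2) ^ c`.
      have hterm : ∀ z, ∀ D, 0 ≤ D → s + Real.log (w z * 2 ^ c) ≤ D →
          ENNReal.ofReal (w z) * A z + (ENNReal.ofReal (w z)
            + ENNReal.ofReal (w z * (D - (s + Real.log (w z * 2 ^ c)))))
          ≤ ENNReal.ofReal (w z) * B z + (ENNReal.ofReal (w z * D)
            + ENNReal.ofReal (Real.exp (-s)) * (ENNReal.ofReal ((1 / 2) ^ c) * U z)) := by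
        intro z D hD hsD
        rcases (hw0 z).eq_or_lt with h | h
        · simp [← h]
        have key := mul_le_mul_right (ih (next z) D (s + Real.log (w z * 2 ^ c)) hD hsD)
          (ENNReal.ofReal (w z))
        have hexp : ENNReal.ofReal (w z) * ENNReal.ofReal
            (Real.exp (-(s + Real.log (w z * 2 ^ c))))
            = ENNReal.ofReal (Real.exp (-s)) * ENNReal.ofReal ((1 / 2) ^ c) := by
          rw [← ENNReal.ofReal_mul (hw0 z), ← ENNReal.ofReal_mul (Real.exp_pos _).le]
          congr 1
          rw [neg_add, Real.exp_add, Real.exp_neg (Real.log _), Real.exp_log (by positivity),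
            one_div, inv_pow]
          field_simp
        rw [mul_add, mul_add, mul_add, mul_add, mul_one, ← mul_assoc _ (ENNReal.ofReal _)
          (F.expect halfNoise O n _ _), hexp, ← ENNReal.ofReal_mul (hw0 z),
          ← ENNReal.ofReal_mul (hw0 z), mul_assoc] at key
        exact key
      -- A common offset for all responses; the excess `D - C` is finite and is cancelled below.
      obtain ⟨D, hCD, hD⟩ : ∃ D, C ≤ D ∧ ∀ z, s + Real.log (w z * 2 ^ c) ≤ D := by
        obtain ⟨D, hD⟩ := (Set.finite_range fun z => s + Real.log (w z * 2 ^ c)).bddAbove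
        exact ⟨max C D, le_max_left _ _, fun z =>
          (hD (Set.mem_range_self z)).trans (le_max_right _ _)⟩
      have htot := Finset.sum_le_sum fun z (_ : z ∈ Finset.univ) =>
        hterm z D (hC.trans hCD) (hD z)
      simp only [Finset.sum_add_distrib] at htot
      rw [hsum, ← ENNReal.ofReal_sum_of_nonneg fun z _ =>
          mul_nonneg (hw0 z) (sub_nonneg.2 (hD z)),
        ← ENNReal.ofReal_sum_of_nonneg fun z _ => mul_nonneg (hw0 z) (hC.trans hCD),
        ← Finset.sum_mul, sum_noiseWeight, one_mul, ← Finset.mul_sum] at htot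
      -- The mean shift of `s` is the relative entropy of this response, paid for by the query just
      -- made.
      have hinfo : D - s ≤ ∑ z, w z * (D - (s + Real.log (w z * 2 ^ c))) + responseInfo c p := by
        have h1 : ∑ z, w z * (D - (s + Real.log (w z * 2 ^ c)))
            = (∑ z, w z) * (D - s) - ∑ z, w z * Real.log (w z * 2 ^ c) := by
          rw [Finset.sum_mul, ← Finset.sum_sub_distrib]
          exact Finset.sum_congr rfl fun z _ => by ring
        rw [h1, sum_noiseWeight]
        linarith [sum_noiseWeight_mul_log_le p (O q)]
      have hfin : ENNReal.ofReal (D - C) ≠ ⊤ := ENNReal.ofReal_ne_top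
      rw [← ENNReal.add_le_add_iff_right hfin]
      have hsplit : ∑ z, ENNReal.ofReal (w z) * (B z + ENNReal.ofReal (responseInfo c p))
          = ∑ z, ENNReal.ofReal (w z) * B z + ENNReal.ofReal (responseInfo c p) := by
        simp only [mul_add, Finset.sum_add_distrib]
        rw [← Finset.sum_mul, hsum, one_mul]
      rw [hsplit]
      have hDs : ENNReal.ofReal (C - s) + ENNReal.ofReal (D - C)
          ≤ ENNReal.ofReal (∑ z, w z * (D - (s + Real.log (w z * 2 ^ c))))
            + ENNReal.ofReal (responseInfo c p) := by
        rw [← ENNReal.ofReal_add (by linarith) (by linarith), ← ENNReal.ofReal_add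
          (Finset.sum_nonneg fun z _ => mul_nonneg (hw0 z) (sub_nonneg.2 (hD z)))
          (responseInfo_nonneg c p)]
        exact ENNReal.ofReal_le_ofReal (by linarith)
      have hDC : ENNReal.ofReal D = ENNReal.ofReal C + ENNReal.ofReal (D - C) := by
        rw [← ENNReal.ofReal_add hC (by linarith)]
        congr 1
        ring
      rw [hDC] at htot
      calc _ = ∑ z, ENNReal.ofReal (w z) * A z
              + (1 + (ENNReal.ofReal (C - s) + ENNReal.ofReal (D - C))) := by ring
        _ ≤ ∑ z, ENNReal.ofReal (w z) * A z
              + (1 + (ENNReal.ofReal (∑ z, w z * (D - (s + Real.log (w z * 2 ^ c))))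
            + ENNReal.ofReal (responseInfo c p))) := by gcongr
        _ = (∑ z, ENNReal.ofReal (w z) * A z
              + (1 + ENNReal.ofReal (∑ z, w z * (D - (s + Real.log (w z * 2 ^ c))))))
            + ENNReal.ofReal (responseInfo c p) := by ring
        _ ≤ _ := add_le_add_left htot _
        _ = _ := by ring

open Classical in
theorem toOuterMeasure_run (n : ℕ) (m : M) (i : 𝕀) :
    (F.run p O n m).toOuterMeasure {r | ∃ j ∈ ({i} : Set 𝕀), r.1 = some j}
      = F.expect p O n m (fun r => if r.1 = some i then 1 else 0) := by
  rw [PMF.toOuterMeasure_apply, expect]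
  refine tsum_congr fun r => ?_
  by_cases h : r.1 = some i <;> simp [h]

open Classical in
/-- Without information, some input is output with probability at most `1 / N`. -/
theorem exists_expect_half_le [Fintype 𝕀] [Nonempty 𝕀] :
    ∃ i, ∀ (O : Q → Bits c) (n : ℕ), (Fintype.card 𝕀 : ℝ≥0∞) *
      F.expect halfNoise O n F.init (fun r => if r.1 = some i then 1 else 0) ≤ 1 := by
  -- The program will depend on `i`, so `i` is chosen with an arbitrary fixed oracle; `run_half_eq`
  -- transfers the bound.
  set R : Q → Bits c := fun _ _ => false
  set g : 𝕀 → Option 𝕀 × ℕ → ℝ≥0∞ := fun i r => if r.1 = some i then 1 else 0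
  have hmono : ∀ i, Monotone fun n => F.expect halfNoise R n F.init (g i) := fun i =>
    F.expect_mono halfNoise R _ (by simp [g]) _
  have hsum : ∀ n, ∑ i, F.expect halfNoise R n F.init (g i) ≤ 1 := by
    intro n
    simp only [expect]
    rw [← Summable.tsum_finsetSum fun i _ => ENNReal.summable,
      ← PMF.tsum_coe (F.run halfNoise R n F.init)]
    refine ENNReal.tsum_le_tsum fun r => ?_
    rw [← Finset.mul_sum]
    refine mul_le_of_le_one_right' ?_
    rcases r with ⟨_ | j, k⟩ <;> simp [g]
  obtain ⟨i, hi⟩ : ∃ i, (Fintype.card 𝕀 : ℝ≥0∞) *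
      (⨆ n, F.expect halfNoise R n F.init (g i)) ≤ 1 := by
    -- Minimizing the suprema gives one `i` that serves every `n`.
    obtain ⟨i, -, hi⟩ := Finset.exists_min_image Finset.univ
      (fun i => ⨆ n, F.expect halfNoise R n F.init (g i)) Finset.univ_nonempty
    refine ⟨i, ?_⟩
    have h := Finset.card_nsmul_le_sum Finset.univ _ _ hi
    rw [nsmul_eq_mul, Finset.card_univ, ENNReal.finsetSum_iSup_of_monotone hmono] at h
    exact h.trans (iSup_le hsum)
  refine ⟨i, fun O n => le_trans ?_ hi⟩
  rw [expect, F.run_half_eq O R]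
  gcongr
  exact le_iSup (fun n => F.expect halfNoise R n F.init (g i)) n

/-- An input that is rarely output without information costs many queries to output often. -/
theorem log_mul_successProb_le (i : 𝕀) (N : ℕ) (hN : 1 ≤ N)
    (hi : ∀ n, (N : ℝ≥0∞) * (F.run halfNoise O n F.init).toOuterMeasure
      {r | ∃ j ∈ ({i} : Set 𝕀), r.1 = some j} ≤ 1) :
    ENNReal.ofReal (Real.log N) * F.successProb p O {i}
      ≤ ENNReal.ofReal (responseInfo c p) * F.expectedQueries p O
        + ENNReal.ofReal (Real.log 2) := by
  classical
  rw [successProb, ENNReal.mul_iSup]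
  refine iSup_le fun n => ?_
  have h2 : (0 : ℝ) < Real.log 2 := Real.log_pos (by norm_num)
  -- Tangent at log 2, because the reference expectation is at most 2; the last term is then at most
  -- 1 and cancels the 1 on the left.
  have key := F.entropy_inequality p O i N hN n F.init (Real.log 2) (Real.log 2) h2.le le_rfl
  have href : F.expect halfNoise O n F.init (fun r => if r.1 = some i then (N : ℝ≥0∞) else 1)
      ≤ 2 := by
    calc _ ≤ F.expect halfNoise O n F.init
          (fun r => (N : ℝ≥0∞) * (if r.1 = some i then 1 else 0) + 1) := by
          refine ENNReal.tsum_le_tsum fun r => mul_le_mul_right ?_ _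
          by_cases h : r.1 = some i <;> simp [h]
      _ ≤ 1 + 1 := by
          rw [expect_add, expect_const, expect_const_mul, ← toOuterMeasure_run]
          exact add_le_add_left (hi n) _
      _ = 2 := one_add_one_eq_two
  have hhalf : ENNReal.ofReal (Real.exp (-Real.log 2)) * 2 = 1 := by
    rw [Real.exp_neg, Real.exp_log (by norm_num), ENNReal.ofReal_inv_of_pos (by norm_num)]
    simpa using ENNReal.inv_mul_cancel (a := 2) (by norm_num) (by norm_num)
  have hA : F.expect p O n F.init
      (fun r => if r.1 = some i then ENNReal.ofReal (Real.log N) else 0)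
      = ENNReal.ofReal (Real.log N) * (F.run p O n F.init).toOuterMeasure
        {r | ∃ j ∈ ({i} : Set 𝕀), r.1 = some j} := by
    rw [toOuterMeasure_run, ← expect_const_mul]
    simp
  have hB : F.expect p O n F.init (fun r => (r.2 : ℝ≥0∞)) ≤ F.expectedQueries p O :=
    le_iSup (fun n => ∑' r, F.run p O n F.init r * (r.2 : ℝ≥0∞)) n
  rw [hA, expect_const_mul, sub_self, ENNReal.ofReal_zero, add_zero] at key
  rw [← ENNReal.add_le_add_iff_right ENNReal.one_ne_top]
  refine key.trans ?_
  rw [add_assoc]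
  refine add_le_add (mul_le_mul_right hB _) (add_le_add_right ?_ _)
  exact (mul_le_mul_right href _).trans hhalf.le

end Fuzzer

/-! ### The lower bound -/

theorem theorem3 (c : ℕ) :
    ∃ K : ℝ, 0 < K ∧ ∀ δ : ℝ, 0 ≤ δ → δ ≤ 1 → ∃ N₀ : ℕ,
      -- the input space (of size at least `N₀`), the control-flow graph and the target edge
      ∀ (𝕀 : Type*) [Fintype 𝕀], N₀ ≤ Fintype.card 𝕀 →
      ∀ (V : Type*) (G : ControlFlowGraph V) (target : V × V),
        (∃ π : G.EntryExitPath, π.Reaches target) →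
        (∃ π : G.EntryExitPath, ¬ π.Reaches target) →
      -- the failure probability and the oracle
      ∀ p : unitInterval, (p : ℝ) < 1 / 2 →
      ∀ (Q : Type*) (oracle : G.Program 𝕀 → Q → Bits c),
      -- the fuzzing algorithm
      ∀ (M : Type*) (F : Fuzzer 𝕀 Q M c),
        (∀ P : G.Program 𝕀, (∃ i, (P i).Reaches target) →
          ENNReal.ofReal (1 - δ) ≤ F.successProb p (oracle P) {i | (P i).Reaches target}) →
        ∃ P : G.Program 𝕀, (∃ i, (P i).Reaches target) ∧
          ENNReal.ofReal (K * ((1 - δ) * Real.log (Fintype.card 𝕀) / (1 / 2 - (p : ℝ)) ^ 2)) ≤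
            F.expectedQueries p (oracle P) := by
  -- 8 is the 4 of `responseInfo` times 2, as `N₀` makes log 2 at most half of (1 - δ) log N. For δ
  -- = 1 division by zero gives `N₀ = 1`, so inputs still exist, and the bound is 0.
  refine ⟨1 / (8 * 2 ^ c), by positivity, fun δ hδ0 hδ1 =>
    ⟨⌈Real.exp (2 * Real.log 2 / (1 - δ))⌉₊, ?_⟩⟩
  intro 𝕀 _ hN V G target ⟨πr, hr⟩ ⟨πn, hn⟩ p hp Q oracle M F hF
  classical
  have hexp : Real.exp (2 * Real.log 2 / (1 - δ)) ≤ Fintype.card 𝕀 := Nat.ceil_le.1 hN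
  have hpos : (0 : ℝ) < Fintype.card 𝕀 := (Real.exp_pos _).trans_le hexp
  have hN1 : 1 ≤ Fintype.card 𝕀 := by exact_mod_cast hpos
  have hlogN : 2 * Real.log 2 / (1 - δ) ≤ Real.log (Fintype.card 𝕀) :=
    (Real.le_log_iff_exp_le hpos).2 hexp
  have : Nonempty 𝕀 := Fintype.card_pos_iff.1 hN1
  obtain ⟨i, hi⟩ := F.exists_expect_half_le
  set P : G.Program 𝕀 := fun j => if j = i then πr else πn with hP
  have hset : {j | (P j).Reaches target} = {i} := by
    ext j
    by_cases h : j = i <;> simp [hP, h, hr, hn]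
  have hreach : ∃ j, (P j).Reaches target := ⟨i, by simpa [hP] using hr⟩
  refine ⟨P, hreach, ?_⟩
  rcases hδ1.eq_or_lt with rfl | hδ
  · simp
  have hsucc := hF P hreach
  rw [hset] at hsucc
  have hmain := F.log_mul_successProb_le p (oracle P) i _ hN1 fun n => by
    rw [F.toOuterMeasure_run]
    exact hi (oracle P) n
  set L := Real.log (Fintype.card 𝕀) with hL
  have hL0 : 0 ≤ L := Real.log_natCast_nonneg _
  have hlog2 : 2 * Real.log 2 ≤ L * (1 - δ) := (div_le_iff₀ (by linarith)).1 hlogN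
  have hε : 0 < 1 / 2 - (p : ℝ) := by linarith
  have hκ : 0 < responseInfo c p := by
    unfold responseInfo
    positivity
  by_cases hT : F.expectedQueries p (oracle P) = ⊤
  · simp [hT]
  have h1 : ENNReal.ofReal (L * (1 - δ)) ≤ ENNReal.ofReal
      (responseInfo c p * (F.expectedQueries p (oracle P)).toReal + Real.log 2) := by
    rw [ENNReal.ofReal_add (by positivity) (Real.log_nonneg (by norm_num)),
      ENNReal.ofReal_mul hκ.le, ENNReal.ofReal_toReal hT, ENNReal.ofReal_mul hL0]
    exact le_trans (by gcongr) hmain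
  rw [ENNReal.ofReal_le_ofReal_iff (by positivity)] at h1
  rw [ENNReal.ofReal_le_iff_le_toReal hT]
  calc 1 / (8 * 2 ^ c) * ((1 - δ) * L / (1 / 2 - (p : ℝ)) ^ 2)
      = (L * (1 - δ) / 2) / responseInfo c p := by
        unfold responseInfo
        field_simp
        ring
    _ ≤ _ := by
        rw [div_le_iff₀ hκ]
        linarith
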